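/- For each integer $k\ge 1$ let $F_k:\mathbb{N}\to\mathbb{N}$ be defined by $F_k(0)=0$ and $F_k(n)=n-F_k^k(n-1)$ for $n\ge 1$, where here and below $F_k^m$ denotes the $m$-th iterate of $F_k$ (not a power). Let $\alpha_k$ be the unique positive root of $X^k+X-1$. For $f,g:\mathbb{N}\to\mathbb{N}$ write $f<_\infty g$ (equivalently $g>_\infty f$) if there is $N$ such that $f(n)<g(n)$ for all $n\ge N$. For every $k\ge 1$, $$F_k<_\infty F_{k+1},\qquad F_k^k>_\infty F_{k+1}^{k+1},\qquad F_k^{k+1}>_\infty F_{k+1}^{k+2}.$$ More generally, let $j\ge 0$. For every $k\ge 1$ such that $\alpha_k\ge \frac{j}{j+1}$ we have $F_k^{k+j}>_\infty F_{k+1}^{k+j+1}$; the condition $\alpha_k\ge\frac{j}{j+1}$ holds in particular whenever $k\ge 1$ and $k\ge j^2$. Conversely, for every $k\ge 1$ such that $\alpha_{k+1}\le\frac{j}{j+1}$ we have $F_k^{k+j}<_\infty F_{k+1}^{k+j+1}$; the condition $\alpha_{k+1}\le\frac{j}{j+1}$ holds in particular whenever $1\le k<j$. -/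

import Mathlib

namespace Hofstadter

/-- Course-of-values table: `table k m` holds the values of `F_k` at `0, …, m` (and `0` beyond `m`). -/
def table (k : ℕ) : ℕ → ℕ → ℕ
  | 0 => fun _ => 0
  | m + 1 => Function.update (table k m) (m + 1) (m + 1 - (table k m)^[k] m)

/-- Hofstadter's function `F_k : ℕ → ℕ`, the function with `F_k 0 = 0` and
`F_k n = n - F_k^k (n - 1)` for `n ≥ 1`, where the exponent denotes iteration;
see `F_zero`, `F_succ` and `F_iterate_le` below. -/
def F (k n : ℕ) : ℕ := table k n n

theorem table_eq_F (k : ℕ) {i m : ℕ} (h : i ≤ m) : table k m i = F k i := by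
  induction m, h using Nat.le_induction with
  | base => rfl
  | succ m him ih =>
    rw [table, Function.update_of_ne (by omega), ih]

theorem table_le (k m i : ℕ) : table k m i ≤ i := by
  induction m generalizing i with
  | zero => simp [table]
  | succ m ih =>
    rw [table]
    by_cases h : i = m + 1
    · subst h
      rw [Function.update_self]
      exact Nat.sub_le _ _
    · rw [Function.update_of_ne h]
      exact ih i

theorem F_le (k n : ℕ) : F k n ≤ n := table_le k n n

theorem F_iterate_le (k j n : ℕ) : (F k)^[j] n ≤ n := by
  induction j generalizing n with
  | zero => exact le_rfl
  | succ j ih => exact (ih (F k n)).trans (F_le k n)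

theorem table_iterate_eq (k j : ℕ) {i m : ℕ} (h : i ≤ m) :
    (table k m)^[j] i = (F k)^[j] i := by
  induction j generalizing i with
  | zero => rfl
  | succ j ih =>
    rw [Function.iterate_succ_apply, Function.iterate_succ_apply, table_eq_F k h]
    exact ih ((F_le k i).trans h)

theorem F_zero (k : ℕ) : F k 0 = 0 := rfl

/-- The defining recursion; by `F_iterate_le` the subtraction is never truncated. -/
theorem F_succ (k n : ℕ) : F k (n + 1) = n + 1 - (F k)^[k] n := by
  rw [← table_iterate_eq k k le_rfl, F, table, Function.update_self]

/-- The polynomial `P_k = X^k + X - 1`. -/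
noncomputable def P (k : ℕ) : Polynomial ℝ :=
  Polynomial.X ^ k + Polynomial.X - 1

theorem existsUnique_root_P {k : ℕ} (hk : 1 ≤ k) :
    ∃! x : ℝ, 0 < x ∧ (P k).IsRoot x := by
  have hk0 : k ≠ 0 := by omega
  have hP : ∀ x : ℝ, (P k).IsRoot x ↔ x ^ k + x = 1 := fun x => by
    simp [P, Polynomial.IsRoot, sub_eq_zero]
  simp only [hP]
  have hmono : StrictMonoOn (fun x : ℝ => x ^ k + x) (Set.Ici 0) := fun a ha b _ hab =>
    add_lt_add (pow_lt_pow_left₀ hab ha hk0) hab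
  have hcont : ContinuousOn (fun x : ℝ => x ^ k + x) (Set.Icc 0 1) := by fun_prop
  obtain ⟨x, hx, hx1⟩ : (1 : ℝ) ∈ (fun x : ℝ => x ^ k + x) '' Set.Icc 0 1 :=
    intermediate_value_Icc zero_le_one hcont ⟨by simp [hk0], by simp⟩
  have hx1' : x ^ k + x = 1 := hx1
  have hx0 : 0 < x := by
    refine lt_of_le_of_ne hx.1 fun h => ?_
    rw [← h] at hx1'
    simp [hk0] at hx1'
  exact ⟨x, ⟨hx0, hx1'⟩, fun y hy =>
    hmono.injOn (Set.mem_Ici.2 hy.1.le) (Set.mem_Ici.2 hx0.le) (hy.2.trans hx1'.symm)⟩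

/-- `α k` is, for `k ≥ 1`, the unique positive root of `P_k = X^k + X - 1`
(see `α_spec` and `α_unique`); its value at `k = 0` is irrelevant. -/
noncomputable def α (k : ℕ) : ℝ :=
  Classical.epsilon fun x : ℝ => 0 < x ∧ (P k).IsRoot x

theorem α_spec {k : ℕ} (hk : 1 ≤ k) : 0 < α k ∧ (P k).IsRoot (α k) :=
  Classical.epsilon_spec (existsUnique_root_P hk).exists

theorem α_unique {k : ℕ} (hk : 1 ≤ k) {x : ℝ} (hx : 0 < x) (hr : (P k).IsRoot x) : x = α k :=
  (existsUnique_root_P hk).unique ⟨hx, hr⟩ (α_spec hk)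

/-- `f` is ultimately (strictly) smaller than `g`. -/
def UltimatelyLT (f g : ℕ → ℕ) : Prop :=
  ∃ N : ℕ, ∀ n : ℕ, N ≤ n → f n < g n

end Hofstadter

open Filter Topology

namespace Hofstadter

/-! Everything follows from `F k n / n → α k`. Iterating gives `(F k)^[j] n / n → α k ^ j`, so
strict inequalities between powers of the roots yield ultimate inequalities. Since `α k ^ (k + j) =
α k ^ j * (1 - α k)` and `α k < α (k + 1)`, the comparisons reduce to the monotonicity of `x ^ j *
(1 - x)`, which peaks at `j / (j + 1)`. For the limit (`tendsto_F_div`), `F (q + 1)` shifts the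
numeration sequence `B q` by one index, even after adding a small remainder (`F_B_add`). The ratios
`B q n / B q (n + 1)` tend to the root, and greedy decomposition carries this over to all `n`. -/

theorem F_step (k n : ℕ) : F k n ≤ F k (n + 1) ∧ F k (n + 1) ≤ F k n + 1 := by
  induction n using Nat.strong_induction_on with
  | _ n ih =>
    rcases n with _ | n
    · rw [F_zero, F_succ]; omega
    · have key : ∀ j, (F k)^[j] n ≤ (F k)^[j] (n + 1) ∧
          (F k)^[j] (n + 1) ≤ (F k)^[j] n + 1 := by
        intro j
        induction j with
        | zero => simp
        | succ j ihj =>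
          rw [Function.iterate_succ_apply', Function.iterate_succ_apply']
          rcases (show (F k)^[j] (n + 1) = (F k)^[j] n ∨
            (F k)^[j] (n + 1) = (F k)^[j] n + 1 by omega) with h | h
          · rw [h]; omega
          · rw [h]; exact ih _ (by have := F_iterate_le k j n; omega)
      have h1 := key k
      have h2 := F_iterate_le k k n
      have h3 := F_iterate_le k k (n + 1)
      rw [F_succ k (n + 1), F_succ k n]
      omega

theorem F_mono (k : ℕ) : Monotone (F k) := monotone_nat_of_le_succ fun n => (F_step k n).1

/-! ### Numeration sequence and the shift property -/

/-- The numeration sequence attached to `F (q + 1)`, started with `q + 1` ones. -/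
def B (q n : ℕ) : ℕ :=
  if n ≤ q then 1 else B q (n - 1) + B q (n - 1 - q)
termination_by n
decreasing_by all_goals omega

theorem B_small {q n : ℕ} (h : n ≤ q) : B q n = 1 := by
  rw [B, if_pos h]

theorem B_rec (q n : ℕ) : B q (n + q + 1) = B q (n + q) + B q n := by
  rw [B, if_neg (by omega)]
  congr 2
  omega

theorem B_pos (q n : ℕ) : 0 < B q n := by
  induction n using Nat.strong_induction_on with
  | _ n ih =>
    by_cases h : n ≤ q
    · simp [B_small h]
    · obtain ⟨m, rfl⟩ : ∃ m, n = m + q + 1 := ⟨n - q - 1, by omega⟩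
      rw [B_rec]
      have := ih m (by omega)
      omega

theorem B_mono (q : ℕ) : Monotone (B q) := by
  refine monotone_nat_of_le_succ fun n => ?_
  by_cases h : n + 1 ≤ q
  · rw [B_small h, B_small (by omega)]
  · obtain ⟨m, rfl⟩ : ∃ m, n = m + q := ⟨n - q, by omega⟩
    rw [B_rec]; omega

theorem lt_B (q n : ℕ) : n < B q (n + q) := by
  induction n with
  | zero => exact B_pos _ _
  | succ n ih =>
    have h := B_rec q n
    have := B_pos q n
    rw [show n + 1 + q = n + q + 1 by ring]; omega

theorem F_iterate_zero (k j : ℕ) : (F k)^[j] 0 = 0 :=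
  Nat.le_zero.1 (F_iterate_le k j 0)

theorem F_one (k : ℕ) : F k 1 = 1 := by
  rw [F_succ, F_iterate_zero]

/-- Strong induction on the argument: the defining recursion needs `q + 1` iterates at the
predecessor, each of which again splits as a term of `B q` plus a small remainder. -/
theorem F_B_add (q N : ℕ) : ∀ n m, q + 1 ≤ n → m ≤ B q (n - q) → B q n + m = N →
    F (q + 1) N = B q (n - 1) + F (q + 1) m := by
  induction N using Nat.strong_induction_on with
  | _ N ih =>
    intro n m hn hm hN
    -- Below index `q` both sides are 1; truncated subtraction is harmless at `i = 0`.
    have hB : ∀ i, B q i < N → F (q + 1) (B q i) = B q (i - 1) := by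
      intro i hi
      by_cases h : i ≤ q
      · rw [B_small h, B_small (by omega), F_one]
      · have := ih _ hi i 0 (by omega) (Nat.zero_le _) rfl
        simpa [F_zero] using this
    have hBj : ∀ j i, B q i < N → (F (q + 1))^[j] (B q i) = B q (i - j) := by
      intro j
      induction j with
      | zero => intro i _; rfl
      | succ j ihj =>
        intro i hi
        rw [Function.iterate_succ_apply', ihj i hi,
          hB _ ((B_mono q (Nat.sub_le i j)).trans_lt hi), Nat.sub_sub]
    -- The bound `2 * q + 1` keeps the index at least `q + 1` each time the induction hypothesis is
    -- used.
    have hadd : ∀ i r, 2 * q + 1 ≤ i → r ≤ B q (i - q) → B q i + r < N → ∀ j, j ≤ q + 1 →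
        (F (q + 1))^[j] (B q i + r) = B q (i - j) + (F (q + 1))^[j] r ∧
        (F (q + 1))^[j] r ≤ B q (i - q - j) := by
      intro i r hi hr hlt j
      induction j with
      | zero => intro _; exact ⟨rfl, hr⟩
      | succ j ihj =>
        intro hj
        obtain ⟨h1, h2⟩ := ihj (by omega)
        rw [Function.iterate_succ_apply', Function.iterate_succ_apply', h1]
        constructor
        · have := F_iterate_le (q + 1) j (B q i + r)
          rw [ih _ (by omega) (i - j) ((F (q + 1))^[j] r) (by omega)
            (by rwa [Nat.sub_right_comm]) rfl, Nat.sub_sub]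
        · refine (F_mono _ h2).trans ?_
          rw [hB _ (lt_of_le_of_lt (B_mono q (by omega)) (lt_of_le_of_lt (Nat.le_add_right _ r) hlt)),
            Nat.sub_sub]
    obtain ⟨p, rfl⟩ : ∃ p, n = p + q + 1 := ⟨n - q - 1, by omega⟩
    have hrec := B_rec q p
    have hp := B_pos q p
    rw [show p + q + 1 - 1 = p + q by omega]
    rcases m with _ | m
    · rw [F_zero]
      obtain ⟨b, hb⟩ : ∃ b, B q p = b + 1 := ⟨B q p - 1, by omega⟩
      have hN' : N = B q (p + q) + b + 1 := by omega
      rw [hN', F_succ]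
      by_cases hpq : p ≤ q
      · have : b = 0 := by have := B_small hpq; omega
        subst this
        rw [Nat.add_zero (B q (p + q)), hBj _ (p + q) (by omega),
          B_small (show p + q - (q + 1) ≤ q by omega)]
        omega
      -- The predecessor of `B q (p + q + 1)` is `B q (p + q) + b`; the unknown iterate of `b`
      -- cancels against the recursion for `F (q + 1) (B q p)`.
      · have h1 := (hadd (p + q) b (by omega)
          (by rw [Nat.add_sub_cancel]; omega) (by omega) (q + 1) le_rfl).1
        have h2 := hB p (by have := B_mono q (show p ≤ p + q by omega); omega)
        rw [hb, F_succ] at h2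
        have h3 := F_iterate_le (q + 1) (q + 1) b
        rw [h1, show p + q - (q + 1) = p - 1 by omega]
        omega
    · have hit : (F (q + 1))^[q + 1] (B q (p + q + 1) + m) = B q p + (F (q + 1))^[q + 1] m := by
        rcases m with _ | m
        · rw [Nat.add_zero (B q _), hBj _ (p + q + 1) (by omega), F_iterate_zero]
          congr 2; omega
        · have hi : 2 * q + 1 ≤ p + q + 1 := by
            by_contra hcon
            have := B_small (show p + q + 1 - q ≤ q by omega)
            omega
          rw [(hadd (p + q + 1) (m + 1) hi (by omega) (by omega) (q + 1) le_rfl).1]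
          congr 2; omega
      rw [← hN, ← Nat.add_assoc, F_succ, hit, F_succ]
      have := F_iterate_le (q + 1) (q + 1) m
      omega

/-- Greedy choice: take the last term before the first one exceeding `n`; the recurrence bounds the
remainder. -/
theorem exists_eq_B_add (q : ℕ) {n : ℕ} (hn : 2 ≤ n) :
    ∃ i m, q + 1 ≤ i ∧ m ≤ B q (i - q) ∧ n = B q i + m := by
  have hex : ∃ i, n < B q i := ⟨n + q, lt_B q n⟩
  have hspec := Nat.find_spec hex
  have hmin := fun j (hj : j < Nat.find hex) => Nat.find_min hex hj
  generalize Nat.find hex = i at hspec hmin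
  have hi : q + 2 ≤ i := by
    by_contra hcon
    have h1 := B_mono q (show i ≤ 0 + q + 1 by omega)
    rw [B_rec, B_small (show 0 + q ≤ q by omega), B_small (Nat.zero_le q)] at h1
    omega
  obtain ⟨p, hp⟩ : ∃ p, i = p + q + 1 := ⟨i - q - 1, by omega⟩
  have h1 := hmin (p + q) (by omega)
  rw [hp, B_rec] at hspec
  exact ⟨p + q, n - B q (p + q), by omega, by rw [Nat.add_sub_cancel]; omega, by omega⟩

/-! ### Convergence under a convex recurrence -/

/-- A sequence satisfying a convex two-term recurrence stays in the interval spanned by a window. -/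
theorem window_bound {a c : ℝ} (ha : 0 < a) (hc : 0 < c) (hac : a + c = 1) {q : ℕ} {u : ℕ → ℝ}
    (hu : ∀ n, u (n + q + 1) = a * u (n + q) + c * u n) {N : ℕ} {x y : ℝ}
    (h : ∀ i ≤ q, x ≤ u (N + i) ∧ u (N + i) ≤ y) (i : ℕ) :
    x ≤ u (N + i) ∧ u (N + i) ≤ y := by
  induction i using Nat.strong_induction_on with
  | _ i ih =>
    by_cases hi : i ≤ q
    · exact h i hi
    · obtain ⟨p, rfl⟩ : ∃ p, i = p + q + 1 := ⟨i - q - 1, by omega⟩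
      have h1 := ih p (by omega)
      have h2 := ih (p + q) (by omega)
      have h3 := hu (N + p)
      simp only [← Nat.add_assoc] at h2 ⊢
      have h4 : ∀ z, a * z + c * z = z := fun z => by rw [← add_mul, hac, one_mul]
      rw [h3]
      constructor
      · linarith [h4 x, mul_le_mul_of_nonneg_left h1.1 hc.le, mul_le_mul_of_nonneg_left h2.1 ha.le]
      · linarith [h4 y, mul_le_mul_of_nonneg_left h1.2 hc.le, mul_le_mul_of_nonneg_left h2.2 ha.le]

/-- The gap of `u N` below `y` enters `u (N + q + 1)` with weight `c`; each later step keeps at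
least a fraction `a` of it. -/
theorem window_upper {a c : ℝ} (ha : 0 < a) (hc : 0 < c) (hac : a + c = 1) {q : ℕ} {u : ℕ → ℝ}
    (hu : ∀ n, u (n + q + 1) = a * u (n + q) + c * u n) {N : ℕ} {y : ℝ}
    (h : ∀ i, u (N + i) ≤ y) (i : ℕ) :
    u (N + (q + 1) + i) ≤ y - a ^ i * c * (y - u N) := by
  have e : c = 1 - a := by linarith
  induction i with
  | zero =>
    have h1 := h q
    have h2 := mul_le_mul_of_nonneg_left h1 ha.le
    rw [Nat.add_zero, ← Nat.add_assoc, hu N]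
    subst e
    nlinarith
  | succ i ih =>
    have h3 := hu (N + i + 1)
    have h4 := mul_le_mul_of_nonneg_left (h (i + 1)) hc.le
    have h5 := mul_le_mul_of_nonneg_left ih ha.le
    rw [show N + (q + 1) + (i + 1) = N + i + 1 + q + 1 by ring, h3, pow_succ]
    rw [show N + (q + 1) + i = N + i + 1 + q by ring] at h5
    rw [← Nat.add_assoc] at h4
    subst e
    nlinarith

theorem exists_window {a c : ℝ} (ha : 0 < a) (hc : 0 < c) (hac : a + c = 1) {q : ℕ} {u : ℕ → ℝ}
    (hu : ∀ n, u (n + q + 1) = a * u (n + q) + c * u n) {N : ℕ} {x y : ℝ}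
    (h : ∀ i, x ≤ u (N + i) ∧ u (N + i) ≤ y) :
    ∃ x' y', (∀ i, x' ≤ u (N + (q + 1) + i) ∧ u (N + (q + 1) + i) ≤ y') ∧
      y' - x' = (1 - a ^ q * c) * (y - x) := by
  -- Both ends move towards `u N`, so the width contracts by a fixed factor wherever `u N` lies.
  refine ⟨x + a ^ q * c * (u N - x), y - a ^ q * c * (y - u N), ?_, by ring⟩
  refine window_bound ha hc hac hu fun i hi => ?_
  have hle : a ^ q ≤ a ^ i := pow_le_pow_of_le_one ha.le (by linarith) hi
  have h0 := h 0
  rw [Nat.add_zero] at h0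
  constructor
  · have h1 := window_upper (u := fun n => - u n) (y := -x) (N := N) ha hc hac
      (fun n => by rw [hu]; ring) (fun i => neg_le_neg (h i).1) i
    have h2 : a ^ q * c * (u N - x) ≤ a ^ i * c * (u N - x) := by
      have : 0 ≤ u N - x := by linarith
      gcongr
    nlinarith
  · have h1 := window_upper ha hc hac hu (fun i => (h i).2) i
    have h2 : a ^ q * c * (y - u N) ≤ a ^ i * c * (y - u N) := by
      have : 0 ≤ y - u N := by linarith
      gcongr
    linarith

theorem exists_windows {a c : ℝ} (ha : 0 < a) (hc : 0 < c) (hac : a + c = 1) {q : ℕ} {u : ℕ → ℝ}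
    (hu : ∀ n, u (n + q + 1) = a * u (n + q) + c * u n) {x y : ℝ}
    (h : ∀ i, x ≤ u i ∧ u i ≤ y) (t : ℕ) :
    ∃ N x' y', (∀ i, x' ≤ u (N + i) ∧ u (N + i) ≤ y') ∧
      y' - x' = (1 - a ^ q * c) ^ t * (y - x) := by
  induction t with
  | zero => exact ⟨0, x, y, fun i => by simpa using h i, by simp⟩
  | succ t ih =>
    obtain ⟨N, x', y', h1, h2⟩ := ih
    obtain ⟨x'', y'', h3, h4⟩ := exists_window ha hc hac hu h1
    exact ⟨_, x'', y'', h3, by rw [h4, h2]; ring⟩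

theorem exists_tendsto_of_convex_rec {a c : ℝ} (ha : 0 < a) (hc : 0 < c) (hac : a + c = 1) {q : ℕ}
    {u : ℕ → ℝ} (hu : ∀ n, u (n + q + 1) = a * u (n + q) + c * u n) {x y : ℝ}
    (h : ∀ i, x ≤ u i ∧ u i ≤ y) : ∃ l, x ≤ l ∧ Tendsto u atTop (𝓝 l) := by
  have hC : CauchySeq u := by
    rw [Metric.cauchySeq_iff']
    intro ε hε
    have hpow : a ^ q ≤ 1 := pow_le_one₀ ha.le (by linarith)
    have hq := pow_pos ha q
    have hlim : Tendsto (fun t : ℕ => (1 - a ^ q * c) ^ t * (y - x)) atTop (𝓝 (0 * (y - x))) :=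
      (tendsto_pow_atTop_nhds_zero_of_lt_one (by nlinarith) (by nlinarith)).mul_const _
    rw [zero_mul] at hlim
    obtain ⟨t, ht⟩ := (hlim.eventually (gt_mem_nhds hε)).exists
    obtain ⟨N, x', y', h1, h2⟩ := exists_windows ha hc hac hu h t
    refine ⟨N, fun n hn => ?_⟩
    obtain ⟨i, rfl⟩ := Nat.exists_eq_add_of_le hn
    have h3 := h1 i
    have h4 := h1 0
    rw [Nat.add_zero] at h4
    rw [Real.dist_eq, abs_lt]
    constructor <;> linarith
  obtain ⟨l, hl⟩ := cauchySeq_tendsto_of_complete hC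
  exact ⟨l, ge_of_tendsto' hl fun i => (h i).1, hl⟩

/-! ### Roots and linear growth of `F` -/

theorem α_pos {k : ℕ} (hk : 1 ≤ k) : 0 < α k := (α_spec hk).1

theorem α_eq {k : ℕ} (hk : 1 ≤ k) : α k ^ k + α k = 1 := by
  have h := (α_spec hk).2
  simpa [P, Polynomial.IsRoot, sub_eq_zero] using h

theorem α_lt_one {k : ℕ} (hk : 1 ≤ k) : α k < 1 := by
  have := α_eq hk
  have := pow_pos (α_pos hk) k
  linarith

theorem le_α {k : ℕ} (hk : 1 ≤ k) {x : ℝ} (h : x ^ k + x ≤ 1) : x ≤ α k := by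
  by_contra! hcon
  have := α_eq hk
  have := pow_le_pow_left₀ (α_pos hk).le hcon.le k
  linarith

theorem α_le {k : ℕ} (hk : 1 ≤ k) {x : ℝ} (hx : 0 ≤ x) (h : 1 ≤ x ^ k + x) : α k ≤ x := by
  by_contra! hcon
  have := α_eq hk
  have := pow_le_pow_left₀ hx hcon.le k
  linarith

theorem α_lt_α_succ {k : ℕ} (hk : 1 ≤ k) : α k < α (k + 1) := by
  by_contra! hcon
  have h1 := α_eq hk
  have h2 := α_eq (show 1 ≤ k + 1 by omega)
  have h3 := pow_le_pow_left₀ (α_pos (show 1 ≤ k + 1 by omega)).le hcon (k + 1)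
  have h4 : α k ^ (k + 1) < α k ^ k :=
    pow_lt_pow_right_of_lt_one₀ (α_pos hk) (α_lt_one hk) (by omega)
  linarith

theorem tendsto_B_ratio (q : ℕ) :
    Tendsto (fun n => (B q n : ℝ) / B q (n + 1)) atTop (𝓝 (α (q + 1))) := by
  have hk : 1 ≤ q + 1 := by omega
  set a := α (q + 1) with ha
  have ha0 : 0 < a := α_pos hk
  have ha1 : a < 1 := α_lt_one hk
  have hae : a + a ^ (q + 1) = 1 := by rw [add_comm]; exact α_eq hk
  -- Rescaling by `a ^ n` makes the recurrence convex, as `a + a ^ (q + 1) = 1`. The lower bound `a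
  -- ^ q` then keeps the limit nonzero.
  have hu : ∀ n, (B q (n + q + 1) : ℝ) * a ^ (n + q + 1) =
      a * ((B q (n + q) : ℝ) * a ^ (n + q)) + a ^ (q + 1) * ((B q n : ℝ) * a ^ n) := by
    intro n
    rw [B_rec]; push_cast; ring
  have hbd := window_bound (u := fun n => (B q n : ℝ) * a ^ n) (N := 0) (x := a ^ q) (y := 1)
    ha0 (pow_pos ha0 _) hae hu (fun i hi => by
      simp only [Nat.zero_add, B_small hi, Nat.cast_one, one_mul]
      exact ⟨pow_le_pow_of_le_one ha0.le ha1.le hi, pow_le_one₀ ha0.le ha1.le⟩)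
  obtain ⟨l, hl, hlim⟩ := exists_tendsto_of_convex_rec (u := fun n => (B q n : ℝ) * a ^ n)
    ha0 (pow_pos ha0 _) hae hu (fun i => by simpa using hbd i)
  have hl0 : l ≠ 0 := ((pow_pos ha0 q).trans_le hl).ne'
  have h := (hlim.div (hlim.comp (tendsto_add_atTop_nat 1)) hl0).mul_const a
  rw [div_self hl0, one_mul] at h
  refine h.congr fun n => ?_
  have h1 : (B q (n + 1) : ℝ) ≠ 0 := by exact_mod_cast (B_pos q (n + 1)).ne'
  simp only [Pi.div_apply, Function.comp_apply]
  field_simp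
  ring

theorem F_discrepancy (q : ℕ) {ε : ℝ} (hε : 0 < ε) :
    ∃ C : ℝ, ∀ n : ℕ, |(F (q + 1) n : ℝ) - α (q + 1) * n| ≤ ε * n + C := by
  have hk : 1 ≤ q + 1 := by omega
  have ha0 := α_pos hk
  have ha1 := α_lt_one hk
  set a := α (q + 1)
  have htriv : ∀ n : ℕ, |(F (q + 1) n : ℝ) - a * n| ≤ n := by
    intro n
    have h1 : (F (q + 1) n : ℝ) ≤ n := by exact_mod_cast F_le _ _
    have h2 : (0 : ℝ) ≤ F (q + 1) n := Nat.cast_nonneg _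
    have h3 : (0 : ℝ) ≤ n := Nat.cast_nonneg _
    rw [abs_le]
    constructor <;> nlinarith
  obtain ⟨I, hI⟩ := Metric.tendsto_atTop.1 (tendsto_B_ratio q) ε hε
  have hdB : ∀ i, I ≤ i → |(B q i : ℝ) - a * B q (i + 1)| ≤ ε * B q (i + 1) := by
    intro i hi
    have h1 := (hI i hi).le
    have h2 : (0 : ℝ) < B q (i + 1) := by exact_mod_cast B_pos q (i + 1)
    rw [Real.dist_eq] at h1
    have h3 : (B q i : ℝ) - a * B q (i + 1) = ((B q i : ℝ) / B q (i + 1) - a) * B q (i + 1) := by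
      field_simp
    rw [h3, abs_mul, abs_of_pos h2]
    gcongr
  -- One summand covers `B q i`, the other the remainder `m`, when `i ≤ I`. For larger `i` the
  -- errors `ε * B q i` and `ε * m` add up without enlarging the constant.
  refine ⟨B q (I + 1) + B q (I + 1), fun n => ?_⟩
  have hBp : (1 : ℝ) ≤ B q (I + 1) := by exact_mod_cast B_pos q (I + 1)
  induction n using Nat.strong_induction_on with
  | _ n ih =>
    have hn0 : (0 : ℝ) ≤ n := Nat.cast_nonneg _
    have hεn : 0 ≤ ε * n := by positivity
    by_cases hn : n < 2
    · have : (n : ℝ) ≤ 2 := by exact_mod_cast hn.le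
      have := htriv n
      linarith
    · obtain ⟨i, m, hi, hm, rfl⟩ := exists_eq_B_add q (not_lt.1 hn)
      by_cases hiI : i ≤ I
      · have h1 : (B q i : ℝ) ≤ B q (I + 1) := by exact_mod_cast B_mono q (by omega)
        have h2 : (m : ℝ) ≤ B q (I + 1) := by
          exact_mod_cast hm.trans (B_mono q (by omega))
        have := htriv (B q i + m)
        push_cast at this hεn ⊢
        linarith
      · obtain ⟨p, rfl⟩ : ∃ p, i = p + 1 := ⟨i - 1, by omega⟩
        rw [F_B_add q _ (p + 1) m hi hm rfl]
        have h1 := hdB p (by omega)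
        have h2 := ih m (by have := B_pos q (p + 1); omega)
        rw [Nat.add_sub_cancel]
        rw [abs_le] at h1 h2 ⊢
        push_cast
        constructor <;> linarith [h1.1, h1.2, h2.1, h2.2]

theorem tendsto_F_div {k : ℕ} (hk : 1 ≤ k) :
    Tendsto (fun n : ℕ => (F k n : ℝ) / n) atTop (𝓝 (α k)) := by
  obtain ⟨q, rfl⟩ : ∃ q, k = q + 1 := ⟨k - 1, by omega⟩
  rw [Metric.tendsto_atTop]
  intro ε hε
  obtain ⟨C, hC⟩ := F_discrepancy q (half_pos hε)
  obtain ⟨N, hN⟩ := exists_nat_gt (2 * C / ε)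
  refine ⟨N + 1, fun n hn => ?_⟩
  have hn0 : (0 : ℝ) < n := by exact_mod_cast (show 0 < n by omega)
  have hNn : (N : ℝ) ≤ n := by exact_mod_cast (show N ≤ n by omega)
  have h1 : 2 * C < ε * n := by
    rw [div_lt_iff₀ hε] at hN
    nlinarith
  have h2 : (F (q + 1) n : ℝ) / n - α (q + 1) = ((F (q + 1) n : ℝ) - α (q + 1) * n) / n := by
    field_simp
  rw [Real.dist_eq, h2, abs_div, abs_of_pos hn0, div_lt_iff₀ hn0]
  linarith [hC n]

theorem tendsto_F_atTop {k : ℕ} (hk : 1 ≤ k) : Tendsto (F k) atTop atTop := by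
  have h := (tendsto_F_div hk).pos_mul_atTop (α_pos hk) tendsto_natCast_atTop_atTop
  rw [← tendsto_natCast_atTop_iff (R := ℝ)]
  refine h.congr' ?_
  filter_upwards [eventually_ne_atTop 0] with n hn
  have : (n : ℝ) ≠ 0 := by exact_mod_cast hn
  field_simp

theorem tendsto_F_iterate_div {k : ℕ} (hk : 1 ≤ k) (j : ℕ) :
    Tendsto (fun n : ℕ => ((F k)^[j] n : ℝ) / n) atTop (𝓝 (α k ^ j)) := by
  induction j with
  | zero =>
    rw [pow_zero]
    refine tendsto_const_nhds.congr' ?_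
    filter_upwards [eventually_ne_atTop 0] with n hn
    have : (n : ℝ) ≠ 0 := by exact_mod_cast hn
    simp [this]
  | succ j ih =>
    have h := (ih.comp (tendsto_F_atTop hk)).mul (tendsto_F_div hk)
    rw [← pow_succ] at h
    refine h.congr' ?_
    filter_upwards [(tendsto_F_atTop hk).eventually (eventually_ne_atTop 0)] with n hn
    have : (F k n : ℝ) ≠ 0 := by exact_mod_cast hn
    simp only [Function.comp_apply, Function.iterate_succ_apply]
    field_simp

theorem ultimatelyLT_of_pow_lt {k l i j : ℕ} (hk : 1 ≤ k) (hl : 1 ≤ l)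
    (h : α k ^ i < α l ^ j) : UltimatelyLT (F k)^[i] (F l)^[j] := by
  have hev := (tendsto_F_iterate_div hk i).eventually_lt (tendsto_F_iterate_div hl j) h
  obtain ⟨N, hN⟩ := eventually_atTop.1 hev
  refine ⟨N + 1, fun n hn => ?_⟩
  have hn0 : (0 : ℝ) < n := by exact_mod_cast (show 0 < n by omega)
  have h1 := hN n (by omega)
  rw [div_lt_div_iff_of_pos_right hn0] at h1
  exact_mod_cast h1

/-! ### Comparing powers of the roots -/

theorem hasDerivAt_pow_mul_one_sub (j : ℕ) (x : ℝ) :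
    HasDerivAt (fun x : ℝ => x ^ (j + 1) * (1 - x)) (x ^ j * ((j + 1) - (j + 2) * x)) x := by
  have h := (hasDerivAt_pow (j + 1) x).mul ((hasDerivAt_id x).const_sub 1)
  refine h.congr_deriv ?_
  simp only [Nat.add_sub_cancel, id_eq]
  push_cast
  ring

theorem strictMonoOn_pow_mul_one_sub (j : ℕ) :
    StrictMonoOn (fun x : ℝ => x ^ j * (1 - x)) (Set.Icc 0 (j / (j + 1))) := by
  refine strictMonoOn_of_deriv_pos (convex_Icc _ _) (by fun_prop) fun x hx => ?_
  rw [interior_Icc] at hx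
  obtain ⟨h0, h1⟩ := hx
  rcases j with _ | j
  · simp only [Nat.cast_zero, zero_div] at h1
    linarith
  · rw [(hasDerivAt_pow_mul_one_sub j x).deriv]
    rw [lt_div_iff₀ (by positivity)] at h1
    push_cast at h1
    exact mul_pos (pow_pos h0 _) (by linarith)

theorem strictAntiOn_pow_mul_one_sub (j : ℕ) :
    StrictAntiOn (fun x : ℝ => x ^ j * (1 - x)) (Set.Ici (j / (j + 1))) := by
  refine strictAntiOn_of_deriv_neg (convex_Ici _) (by fun_prop) fun x hx => ?_
  rw [interior_Ici, Set.mem_Ioi] at hx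
  have h0 : 0 < x := lt_of_le_of_lt (by positivity) hx
  rcases j with _ | j
  · simp
  · rw [(hasDerivAt_pow_mul_one_sub j x).deriv]
    rw [div_lt_iff₀ (by positivity)] at hx
    push_cast at hx
    exact mul_neg_of_pos_of_neg (pow_pos h0 _) (by linarith)

/-- Removes `k` from the exponent, so that consecutive roots are compared through one function. -/
theorem α_pow_add {k : ℕ} (hk : 1 ≤ k) (j : ℕ) : α k ^ (k + j) = α k ^ j * (1 - α k) := by
  rw [pow_add, eq_sub_of_add_eq (α_eq hk)]; ring

theorem ultimatelyLT_of_le_α {j k : ℕ} (hk : 1 ≤ k) (h : (j : ℝ) / ((j : ℝ) + 1) ≤ α k) :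
    UltimatelyLT (F (k + 1))^[k + j + 1] (F k)^[k + j] := by
  refine ultimatelyLT_of_pow_lt (by omega) hk ?_
  rw [show k + j + 1 = k + 1 + j by ring, α_pow_add hk, α_pow_add (by omega)]
  have hlt := α_lt_α_succ hk
  exact strictAntiOn_pow_mul_one_sub j (Set.mem_Ici.2 h) (Set.mem_Ici.2 (h.trans hlt.le)) hlt

theorem ultimatelyLT_of_α_le {j k : ℕ} (hk : 1 ≤ k) (h : α (k + 1) ≤ (j : ℝ) / ((j : ℝ) + 1)) :
    UltimatelyLT (F k)^[k + j] (F (k + 1))^[k + j + 1] := by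
  refine ultimatelyLT_of_pow_lt hk (by omega) ?_
  rw [show k + j + 1 = k + 1 + j by ring, α_pow_add hk, α_pow_add (by omega)]
  have hlt := α_lt_α_succ hk
  exact strictMonoOn_pow_mul_one_sub j ⟨(α_pos hk).le, hlt.le.trans h⟩
    ⟨(α_pos (by omega)).le, h⟩ hlt

theorem div_succ_le_α {j k : ℕ} (hk : 1 ≤ k) (h : j ^ 2 ≤ k) :
    (j : ℝ) / ((j : ℝ) + 1) ≤ α k := by
  rcases Nat.eq_zero_or_pos j with rfl | hj
  · simpa using (α_pos hk).le
  refine le_α hk ?_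
  have hj0 : (0 : ℝ) < j := by exact_mod_cast hj
  have hx0 : 0 ≤ (j : ℝ) / (j + 1) := by positivity
  have hx1 : (j : ℝ) / (j + 1) ≤ 1 := by rw [div_le_one (by positivity)]; linarith
  have h1 := pow_le_pow_of_le_one hx0 hx1 h
  have hinv : 0 < 1 / (j : ℝ) := by positivity
  -- Bernoulli: `(1 + 1 / j) ^ (j ^ 2) ≥ 1 + j`, which is where `j ^ 2` comes from.
  have h2 := one_add_mul_le_pow (a := 1 / (j : ℝ)) (by linarith) (j ^ 2)
  have h3 : (1 : ℝ) + ((j ^ 2 : ℕ) : ℝ) * (1 / j) = j + 1 := by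
    push_cast; field_simp; ring
  rw [h3] at h2
  have h4 : ((j : ℝ) / (j + 1)) ^ (j ^ 2) ≤ 1 / (j + 1) := by
    rw [show (j : ℝ) / (j + 1) = (1 + 1 / (j : ℝ))⁻¹ by field_simp, inv_pow,
      one_div ((j : ℝ) + 1)]
    exact inv_anti₀ (by positivity) h2
  have h5 : 1 / ((j : ℝ) + 1) + j / (j + 1) = 1 := by field_simp; ring
  linarith

theorem α_succ_le_div {j k : ℕ} (h : k < j) : α (k + 1) ≤ (j : ℝ) / ((j : ℝ) + 1) := by
  have hx0 : 0 ≤ (j : ℝ) / (j + 1) := by positivity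
  have hx1 : (j : ℝ) / (j + 1) ≤ 1 := by rw [div_le_one (by positivity)]; linarith
  refine α_le (by omega) hx0 ?_
  have h1 := pow_le_pow_of_le_one hx0 hx1 (show k + 1 ≤ j by omega)
  -- Bernoulli again: `x ^ j ≥ 1 + j * (x - 1)`, which equals `1 - x` at `x = j / (j + 1)`.
  have h2 := one_add_mul_sub_le_pow (a := (j : ℝ) / (j + 1)) (by linarith) j
  have h3 : 1 + (j : ℝ) * ((j : ℝ) / (j + 1) - 1) + j / (j + 1) = 1 := by field_simp; ring
  linarith

end Hofstadter

theorem corollary6p4 :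
    (∀ k : ℕ, 1 ≤ k →
      Hofstadter.UltimatelyLT (Hofstadter.F k) (Hofstadter.F (k + 1)) ∧
      Hofstadter.UltimatelyLT (Hofstadter.F (k + 1))^[k + 1] (Hofstadter.F k)^[k] ∧
      Hofstadter.UltimatelyLT (Hofstadter.F (k + 1))^[k + 2] (Hofstadter.F k)^[k + 1]) ∧
    (∀ j k : ℕ, 1 ≤ k →
      ((j : ℝ) / ((j : ℝ) + 1) ≤ Hofstadter.α k →
        Hofstadter.UltimatelyLT (Hofstadter.F (k + 1))^[k + j + 1] (Hofstadter.F k)^[k + j]) ∧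
      (j ^ 2 ≤ k → (j : ℝ) / ((j : ℝ) + 1) ≤ Hofstadter.α k) ∧
      (Hofstadter.α (k + 1) ≤ (j : ℝ) / ((j : ℝ) + 1) →
        Hofstadter.UltimatelyLT (Hofstadter.F k)^[k + j] (Hofstadter.F (k + 1))^[k + j + 1]) ∧
      (k < j → Hofstadter.α (k + 1) ≤ (j : ℝ) / ((j : ℝ) + 1))) := by

  refine ⟨fun k hk => ⟨?_, ?_, ?_⟩, fun j k hk => ⟨Hofstadter.ultimatelyLT_of_le_α hk,
    Hofstadter.div_succ_le_α hk, Hofstadter.ultimatelyLT_of_α_le hk, Hofstadter.α_succ_le_div⟩⟩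
  · simpa using Hofstadter.ultimatelyLT_of_pow_lt (i := 1) (j := 1) hk (by omega)
      (by simpa using Hofstadter.α_lt_α_succ hk)
  · exact Hofstadter.ultimatelyLT_of_le_α (j := 0) hk (by simpa using (Hofstadter.α_pos hk).le)
  · exact Hofstadter.ultimatelyLT_of_le_α (j := 1) hk (Hofstadter.div_succ_le_α hk (by simpa using hk))
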